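/- **Setting.** Let $M=\mathbb Z^3$. For a finite set $V\subset M$ whose convex hull $\Delta\subset\mathbb R^3$ is a reflexive polytope (i.e. its polar dual $\Delta^*=\{y : (x,y)\ge -1\ \text{for all } x\in\Delta\}$ is again the convex hull of finitely many lattice points), let $\mathbb P_\Delta=\operatorname{Proj}\bigoplus_{k\ge 0}\bigoplus_{m\in k\Delta\cap M}\mathbb C\,\chi^m t^k$ be the associated projective toric threefold over $\mathbb C$, and let $\mathcal F_\Delta$ be the family of hypersurfaces of $\mathbb P_\Delta$ parametrised by the complete anticanonical linear system, i.e. by the projective space $|{-}K_{\mathbb P_\Delta}|$ of nonzero Laurent polynomials $\sum_{m\in\Delta\cap M}c_m\chi^m$ up to scalars. Two families $\mathcal F_\Delta$, $\mathcal F_{\Delta'}$ are called *essentially the same* if their general members are birationally equivalent, in the following sense: for all nonempty Zariski open subsets $W\subset|{-}K_{\mathbb P_\Delta}|$ and $W'\subset|{-}K_{\mathbb P_{\Delta'}}|$ there are nonempty Zariski open subsets $U\subset W$, $U'\subset W'$ and a bijection $e:U\to U'$ such that for every $x\in U$ the member of $\mathcal F_\Delta$ with parameter $x$ and the member of $\mathcal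 F_{\Delta'}$ with parameter $e(x)$ are birationally equivalent over $\mathbb C$. Let the following four reflexive polytopes be defined as convex hulls: - $\Delta_{Q_{12}}=\operatorname{conv}\{(1,1,-2),(1,-2,1),(2,-3,2),(-1,0,1),(-1,0,0),(1,0,-1),(1,-1,0)\}$, - $\Delta_{Q_{18}}=\operatorname{conv}\{(0,0,1),(1,0,0),(-4,-3,-1),(-3,-2,0),(0,1,0),(-2,-1,0),(-1,0,0)\}$, - $\Delta_{Z_{1,0}}=\operatorname{conv}\{(1,-3,-1),(2,0,-1),(1,0,-1),(0,-1,-1),(-1,2,1),(0,1,0)\}$, - $\Delta_{E_{25}}=\operatorname{conv}\{(0,1,0),(0,0,1),(-3,-2,0),(-5,-3,-1),(1,0,0),(-1,-1,0)\}$. **Proposition 4.1.** The matrices $$M_1=\begin{pmatrix}-1&0&1\\1&1&-2\\2&-3&2\end{pmatrix},\qquad M_2=\begin{pmatrix}-1&2&1\\1&-3&-1\\2&0&-1\end{pmatrix}$$ lie in $GL_3(\mathbb Z)$, the map $m\mapsto mM_1$ (row vectors) carries $\Delta_{Q_{18}}$ onto $\Delta_{Q_{12}}$, and $m\mapsto mM_2$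 carries $\Delta_{E_{25}}$ onto $\Delta_{Z_{1,0}}$. Moreover, the families $\mathcal F_{\Delta_{Q_{12}}}$ and $\mathcal F_{\Delta_{Q_{18}}}$ are essentially the same, and the families $\mathcal F_{\Delta_{Z_{1,0}}}$ and $\mathcal F_{\Delta_{E_{25}}}$ are essentially the same. -/

import Mathlib

noncomputable section

open CategoryTheory AlgebraicGeometry

open scoped Pointwise

/-! ### Graded quotients -/

/-- The grading that a homogeneous ideal `I` of a graded algebra induces on the quotient by `I`:
the degree `k` part is the image of the degree `k` part. -/
def quotientGrading {R A : Type} [CommRing R] [CommRing A] [Algebra R A]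
    (𝒜 : ℕ → Submodule R A) [GradedAlgebra 𝒜] (I : HomogeneousIdeal 𝒜) :
    ℕ → Submodule R (A ⧸ I.toIdeal) :=
  fun k => (𝒜 k).map (Ideal.Quotient.mkₐ R I.toIdeal).toLinearMap

section quotientGrading

variable {R A : Type} [CommRing R] [CommRing A] [Algebra R A]
  (𝒜 : ℕ → Submodule R A) [GradedAlgebra 𝒜] (I : HomogeneousIdeal 𝒜)

theorem mk_mem_quotientGrading {k : ℕ} {a : A} (ha : a ∈ 𝒜 k) :
    Ideal.Quotient.mk I.toIdeal a ∈ quotientGrading 𝒜 I k :=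
  ⟨a, ha, rfl⟩

instance quotientGrading.gradedMonoid : SetLike.GradedMonoid (quotientGrading 𝒜 I) where
  one_mem := ⟨1, SetLike.GradedOne.one_mem, by simp⟩
  mul_mem := by
    rintro i j _ _ ⟨a, ha, rfl⟩ ⟨b, hb, rfl⟩
    exact ⟨a * b, SetLike.GradedMul.mul_mem ha hb, by simp⟩

/-- The projection from a graded algebra to the direct sum of the graded pieces of the quotient. -/
def quotientDecomposeAux : A →ₗ[R] DirectSum ℕ fun k => quotientGrading 𝒜 I k :=
  (DirectSum.lmap fun k => ((Ideal.Quotient.mkₐ R I.toIdeal).toLinearMap.restrict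
    (p := 𝒜 k) (q := quotientGrading 𝒜 I k) fun _ ha => mk_mem_quotientGrading 𝒜 I ha)) ∘ₗ
    (DirectSum.decomposeLinearEquiv 𝒜).toLinearMap

theorem quotientDecomposeAux_apply (a : A) (k : ℕ) :
    (quotientDecomposeAux 𝒜 I a k : A ⧸ I.toIdeal) =
      Ideal.Quotient.mk I.toIdeal (DirectSum.decompose 𝒜 a k : A) := rfl

theorem quotientDecomposeAux_eq_zero (a : A) (ha : a ∈ I.toIdeal) :
    quotientDecomposeAux 𝒜 I a = 0 := by
  refine DFinsupp.ext fun k => Subtype.ext ?_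
  refine (quotientDecomposeAux_apply 𝒜 I a k).trans ?_
  exact Ideal.Quotient.eq_zero_iff_mem.2 (I.2 k ha)

/-- The decomposition of the quotient into its graded pieces. -/
def quotientDecompose :
    (A ⧸ I.toIdeal) →+ DirectSum ℕ fun k => quotientGrading 𝒜 I k :=
  QuotientAddGroup.lift (Submodule.toAddSubgroup I.toIdeal)
    (quotientDecomposeAux 𝒜 I).toAddMonoidHom
    fun a ha => quotientDecomposeAux_eq_zero 𝒜 I a ha

instance quotientGrading.gradedAlgebra : GradedAlgebra (quotientGrading 𝒜 I) where
  decompose' := quotientDecompose 𝒜 I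
  left_inv := by
    intro x
    obtain ⟨a, rfl⟩ := Ideal.Quotient.mk_surjective x
    change DirectSum.coeAddMonoidHom (quotientGrading 𝒜 I) (quotientDecomposeAux 𝒜 I a) = _
    induction a using DirectSum.Decomposition.inductionOn 𝒜 with
    | zero => simp
    | @homogeneous i a =>
      have : quotientDecomposeAux 𝒜 I a = DirectSum.of (fun k => quotientGrading 𝒜 I k) i
          ⟨_, mk_mem_quotientGrading 𝒜 I a.2⟩ := by
        simp only [quotientDecomposeAux, LinearMap.comp_apply, LinearEquiv.coe_coe,
          DirectSum.decomposeLinearEquiv_apply, DirectSum.decompose_coe]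
        exact DirectSum.lmap_lof _ _ _
      rw [this, DirectSum.coeAddMonoidHom_of]
    | add a b ha hb => simp [ha, hb]
  right_inv := by
    intro x
    induction x using DirectSum.induction_on with
    | zero => simp
    | of i x =>
      obtain ⟨_, a, ha, rfl⟩ := x
      rw [DirectSum.coeAddMonoidHom_of]
      change quotientDecomposeAux 𝒜 I a = _
      simp only [quotientDecomposeAux, LinearMap.comp_apply, LinearEquiv.coe_coe,
        DirectSum.decomposeLinearEquiv_apply, DirectSum.decompose_of_mem 𝒜 ha]
      exact DirectSum.lmap_lof _ _ _
    | add x y hx hy => simp only [map_add, hx, hy]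

/-- The quotient map by a homogeneous ideal, as a homomorphism of graded rings. -/
def quotientGradedHom : 𝒜 →+*ᵍ quotientGrading 𝒜 I where
  __ := Ideal.Quotient.mk I.toIdeal
  map_mem := fun ha => mk_mem_quotientGrading 𝒜 I ha

theorem irrelevant_le_map_quotientGradedHom :
    HomogeneousIdeal.irrelevant (quotientGrading 𝒜 I) ≤
      (HomogeneousIdeal.irrelevant 𝒜).map (quotientGradedHom 𝒜 I) := by
  rw [HomogeneousIdeal.irrelevant_le]
  rintro i hi _ ⟨a, ha, rfl⟩
  exact Ideal.mem_map_of_mem (quotientGradedHom 𝒜 I)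
    (HomogeneousIdeal.mem_irrelevant_of_mem 𝒜 hi ha)

end quotientGrading

/-! ### Lattice polytopes and reflexivity -/

/-- A lattice point of `M = ℤ³`, as a point of `M ⊗ ℝ = ℝ³`. -/
def latticeToReal (m : Fin 3 → ℤ) : Fin 3 → ℝ := fun i => (m i : ℝ)

/-- The lattice polytope in `ℝ³` spanned by a finite set of lattice points. -/
def latticeHull (V : Finset (Fin 3 → ℤ)) : Set (Fin 3 → ℝ) :=
  convexHull ℝ (latticeToReal '' (V : Set (Fin 3 → ℤ)))

/-- The polar dual `Δ* = {y | (x, y) ≥ -1 for all x ∈ Δ}`. -/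
def polarDual (Δ : Set (Fin 3 → ℝ)) : Set (Fin 3 → ℝ) :=
  {y | ∀ x ∈ Δ, -1 ≤ x ⬝ᵥ y}

/-- A reflexive polytope, given by lattice points spanning it and lattice points spanning its
polar dual. (As the polar dual is bounded, the origin is an interior point.) -/
structure ReflexivePolytope where
  points : Finset (Fin 3 → ℤ)
  nonempty : points.Nonempty
  dualPoints : Finset (Fin 3 → ℤ)
  polar_eq : polarDual (latticeHull points) = latticeHull dualPoints

theorem polarDual_latticeHull_eq {V W : Finset (Fin 3 → ℤ)}
    (hVW : ∀ v ∈ V, ∀ w ∈ W, -1 ≤ v ⬝ᵥ w)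
    (h : ∀ y : Fin 3 → ℝ, (∀ v ∈ V, -1 ≤ latticeToReal v ⬝ᵥ y) → y ∈ latticeHull W) :
    polarDual (latticeHull V) = latticeHull W := by
  apply Set.Subset.antisymm
  · intro y hy
    exact h y fun v hv => hy _ (subset_convexHull ℝ _ ⟨v, hv, rfl⟩)
  · have key : ∀ v ∈ V, ∀ y ∈ latticeHull W, -1 ≤ latticeToReal v ⬝ᵥ y := by
      intro v hv y hy
      have hc : Convex ℝ {y : Fin 3 → ℝ | -1 ≤ latticeToReal v ⬝ᵥ y} :=
        convex_halfSpace_ge (f := fun y => latticeToReal v ⬝ᵥ y)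
          ⟨fun a b => dotProduct_add _ a b, fun c a => dotProduct_smul c _ a⟩ _
      refine convexHull_min ?_ hc hy
      rintro _ ⟨w, hw, rfl⟩
      have := hVW v hv w hw
      simp only [Set.mem_ofPred_eq, latticeToReal, dotProduct]
      exact_mod_cast this
    intro y hy x hx
    have hc : Convex ℝ {x : Fin 3 → ℝ | -1 ≤ x ⬝ᵥ y} :=
      convex_halfSpace_ge (f := fun x => x ⬝ᵥ y)
        ⟨fun a b => add_dotProduct a b _, fun c a => smul_dotProduct c a _⟩ _
    refine convexHull_min ?_ hc hx
    rintro _ ⟨v, hv, rfl⟩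
    exact key v hv y hy

theorem mem_latticeHull_of_barycentric {W : Finset (Fin 3 → ℤ)} {y : Fin 3 → ℝ}
    (a b c d : Fin 3 → ℤ) (ha : a ∈ W) (hb : b ∈ W) (hc : c ∈ W) (hd : d ∈ W)
    (p q r s : ℝ) (hp : 0 ≤ p) (hq : 0 ≤ q) (hr : 0 ≤ r) (hs : 0 ≤ s) (h : p + q + r + s = 1)
    (hy : p • latticeToReal a + q • latticeToReal b + r • latticeToReal c
      + s • latticeToReal d = y) :
    y ∈ latticeHull W := by
  have hconv : Convex ℝ (latticeHull W) := convex_convexHull ℝ _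
  have hmem : ∀ w ∈ W, latticeToReal w ∈ latticeHull W := fun w hw =>
    subset_convexHull ℝ _ ⟨w, hw, rfl⟩
  have := hconv.sum_mem (t := Finset.univ) (w := ![p, q, r, s])
    (z := ![latticeToReal a, latticeToReal b, latticeToReal c, latticeToReal d])
    (by intro i _; fin_cases i <;> simpa) (by simpa [Fin.sum_univ_four] using h)
    (by intro i _; fin_cases i <;> simp [*])
  rw [← hy]
  simpa [Fin.sum_univ_four] using this

/-! ### Families of anticanonical hypersurfaces in toric threefolds -/

namespace ReflexivePolytope

variable (Δ : ReflexivePolytope)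

/-- The polytope as a subset of `M ⊗ ℝ`. -/
def body : Set (Fin 3 → ℝ) := latticeHull Δ.points

/-- The monoid of lattice points `(m, k)` of the cone over `Δ × {1}`, i.e. with `m ∈ kΔ`. -/
def coneMonoid : AddSubmonoid ((Fin 3 → ℤ) × ℕ) where
  carrier := {z | latticeToReal z.1 ∈ (z.2 : ℝ) • Δ.body}
  zero_mem' := by
    obtain ⟨v, hv⟩ := Δ.nonempty
    refine ⟨latticeToReal v, subset_convexHull ℝ _ ⟨v, hv, rfl⟩, ?_⟩
    ext i
    simp [latticeToReal]
  add_mem' := by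
    intro z w hz hw
    have hc : Convex ℝ Δ.body := convex_convexHull ℝ _
    have := Set.add_mem_add (show latticeToReal z.1 ∈ (z.2 : ℝ) • Δ.body from hz)
      (show latticeToReal w.1 ∈ (w.2 : ℝ) • Δ.body from hw)
    rw [← hc.add_smul (Nat.cast_nonneg z.2) (Nat.cast_nonneg w.2)] at this
    have e : latticeToReal (z + w).1 = latticeToReal z.1 + latticeToReal w.1 := by
      ext i
      simp [latticeToReal]
    change latticeToReal (z + w).1 ∈ (((z + w).2 : ℕ) : ℝ) • Δ.body
    rw [e, Prod.snd_add, Nat.cast_add]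
    exact this

/-- The polytope algebra: it has a basis of monomials `χ^m t^k` with `m ∈ kΔ ∩ M`. -/
abbrev polytopeAlgebra : Type := AddMonoidAlgebra ℂ Δ.coneMonoid

/-- The degree in `t`. -/
def coneDegree : Δ.coneMonoid →+ ℕ := (AddMonoidHom.snd _ _).comp Δ.coneMonoid.subtype

/-- The grading of the polytope algebra by the degree in `t`. -/
def grading : ℕ → Submodule ℂ Δ.polytopeAlgebra := AddMonoidAlgebra.gradeBy ℂ Δ.coneDegree

instance : GradedAlgebra Δ.grading :=
  inferInstanceAs (GradedAlgebra (AddMonoidAlgebra.gradeBy ℂ Δ.coneDegree))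

/-- The projective toric threefold `ℙ_Δ`. As `Δ` is reflexive, its sheaf `𝒪(1)` is the
anticanonical sheaf. -/
def toricVariety : Scheme := Proj Δ.grading

/-- The structure morphism of `ℙ_Δ` over `ℂ`. -/
def toricVarietyToSpec : Δ.toricVariety ⟶ Spec (.of ℂ) :=
  Proj.toSpecZero Δ.grading ≫ Spec.map (CommRingCat.ofHom (algebraMap ℂ (Δ.grading 0)))

/-- The lattice points of `Δ`. -/
def latticePoints : Set (Fin 3 → ℤ) := {m | latticeToReal m ∈ Δ.body}

/-- The space of global sections of the anticanonical sheaf of `ℙ_Δ`, i.e. of the Laurent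
polynomials `∑ c_m χ^m` supported on the lattice points `m` of `Δ`, given by their coefficients. -/
abbrev AnticanonicalSections : Type := Δ.latticePoints →₀ ℂ

/-- The complete anticanonical linear system of `ℙ_Δ`, the parameter space of the family. -/
abbrev AnticanonicalSystem : Type := Projectivization ℂ Δ.AnticanonicalSections

/-- The monomial `χ^m t`, for a lattice point `m` of `Δ`, as an element of the cone. -/
def liftPoint (m : Δ.latticePoints) : Δ.coneMonoid :=
  ⟨(m.1, 1), by
    change latticeToReal m.1 ∈ ((1 : ℕ) : ℝ) • Δ.body
    rw [Nat.cast_one, one_smul]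
    exact m.2⟩

/-- The element `∑ c_m χ^m t` of degree one of the polytope algebra attached to a section. -/
def homogenize (F : Δ.AnticanonicalSections) : Δ.polytopeAlgebra :=
  F.sum fun m c => AddMonoidAlgebra.single (Δ.liftPoint m) c

theorem homogenize_mem (F : Δ.AnticanonicalSections) : Δ.homogenize F ∈ Δ.grading 1 :=
  Submodule.sum_mem _ fun m _ =>
    AddMonoidAlgebra.single_mem_gradeBy Δ.coneDegree (Δ.liftPoint m) (F m)

/-- The homogeneous ideal generated by a section. -/
def sectionIdeal (F : Δ.AnticanonicalSections) : HomogeneousIdeal Δ.grading where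
  toSubmodule := Ideal.span {Δ.homogenize F}
  is_homogeneous' := Ideal.homogeneous_span _ _ (by
    rintro _ rfl
    exact ⟨1, Δ.homogenize_mem F⟩)

/-- The hypersurface in `ℙ_Δ` cut out by a section of the anticanonical sheaf. -/
def hypersurface (F : Δ.AnticanonicalSections) : Scheme :=
  Proj (quotientGrading Δ.grading (Δ.sectionIdeal F))

/-- The inclusion of the hypersurface in `ℙ_Δ`. -/
def hypersurfaceι (F : Δ.AnticanonicalSections) : Δ.hypersurface F ⟶ Δ.toricVariety :=
  Proj.map (quotientGradedHom Δ.grading (Δ.sectionIdeal F))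
    (irrelevant_le_map_quotientGradedHom Δ.grading (Δ.sectionIdeal F))

/-- The structure morphism over `ℂ` of the member of the family with parameter `x`. It does not
depend on the section that represents `x`, since proportional sections have the same ideal. -/
def memberToSpec (x : Δ.AnticanonicalSystem) : Δ.hypersurface x.rep ⟶ Spec (.of ℂ) :=
  Δ.hypersurfaceι x.rep ≫ Δ.toricVarietyToSpec

/-- Zariski open subsets of the anticanonical linear system: the loci where not all of a set of
homogeneous polynomials in the coefficients vanish. -/
def IsZariskiOpen (U : Set Δ.AnticanonicalSystem) : Prop :=
  ∃ S : Set (MvPolynomial Δ.latticePoints ℂ),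
    (∀ p ∈ S, ∃ n, p.IsHomogeneous n) ∧ U = {x | ∃ p ∈ S, MvPolynomial.eval x.rep p ≠ 0}

/-- Two families are essentially the same if their general members are birationally equivalent:
however general the members are required to be (`W` and `W'`), there are nonempty Zariski open
sets of such members in the two families and a bijective correspondence between them under which
corresponding members are birationally equivalent over `ℂ`. -/
def EssentiallySame (Δ Δ' : ReflexivePolytope) : Prop :=
  ∀ (W : Set Δ.AnticanonicalSystem) (W' : Set Δ'.AnticanonicalSystem),
    Δ.IsZariskiOpen W → W.Nonempty → Δ'.IsZariskiOpen W' → W'.Nonempty →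
    ∃ (U : Set Δ.AnticanonicalSystem) (U' : Set Δ'.AnticanonicalSystem),
      U ⊆ W ∧ Δ.IsZariskiOpen U ∧ U.Nonempty ∧ U' ⊆ W' ∧ Δ'.IsZariskiOpen U' ∧ U'.Nonempty ∧
      ∃ e : U ≃ U', ∀ x : U,
        Scheme.BirationalOver (Δ.memberToSpec x.1) (Δ'.memberToSpec (e x).1)

end ReflexivePolytope

/-! ### The polytopes -/

/-- The reflexive polytope of the singularity `Q_{12}`. -/
def polytopeQ12 : ReflexivePolytope where
  points :=
    {![1, 1, -2], ![1, -2, 1], ![2, -3, 2], ![-1, 0, 1], ![-1, 0, 0], ![1, 0, -1], ![1, -1, 0]}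
  nonempty := ⟨_, Finset.mem_insert_self _ _⟩
  dualPoints :=
    {![1, 2, 2], ![0, 1, 1], ![-8, -11, -9], ![1, -2, 0], ![1, 1, 0], ![-4, -5, -4],
     ![-7, -10, -8], ![-6, -9, -7], ![-5, -8, -6], ![-4, -7, -5], ![-3, -6, -4], ![-2, -5, -3],
     ![-1, -4, -2], ![0, -3, -1], ![1, 0, 1], ![-5, -7, -6], ![-2, -3, -3], ![1, -1, 0],
     ![1, 0, 0]}
  polar_eq := by
    refine polarDual_latticeHull_eq (by decide) fun y hy => ?_
    simp [dotProduct, Fin.sum_univ_three, latticeToReal] at hy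
    rcases le_total 0 (-1/2 + (-5/2) * y 0 + (3) * y 1 + (-3/2) * y 2 : ℝ) with hs | hs
    · refine mem_latticeHull_of_barycentric ![1, 2, 2] ![0, 1, 1]
        ![-8, -11, -9] ![1, 1, 0] (by decide) (by decide) (by decide) (by decide)
        (1 + (2) * y 0 + (-3) * y 1 + (2) * y 2 : ℝ)
        (-1/2 + (-5/2) * y 0 + (3) * y 1 + (-3/2) * y 2 : ℝ)
        (1/6 + (1/6) * y 0 + (-1/3) * y 1 + (1/6) * y 2 : ℝ)
        (1/3 + (1/3) * y 0 + (1/3) * y 1 + (-2/3) * y 2 : ℝ) ?_ ?_ ?_ ?_ ?_ ?_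
      any_goals linarith
      ext i
      fin_cases i <;> simp [latticeToReal] <;> linarith
    · refine mem_latticeHull_of_barycentric ![1, 2, 2] ![1, -2, 0]
        ![-8, -11, -9] ![1, 1, 0] (by decide) (by decide) (by decide) (by decide)
        (1/2 + (-1/2) * y 0 + (1/2) * y 2 : ℝ)
        (1/18 + (5/18) * y 0 + (-1/3) * y 1 + (1/6) * y 2 : ℝ)
        (1/9 + (-1/9) * y 0 : ℝ)
        (1/3 + (1/3) * y 0 + (1/3) * y 1 + (-2/3) * y 2 : ℝ) ?_ ?_ ?_ ?_ ?_ ?_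
      any_goals linarith
      ext i
      fin_cases i <;> simp [latticeToReal] <;> linarith

/-- The reflexive polytope of the singularity `Q_{18}`. -/
def polytopeQ18 : ReflexivePolytope where
  points :=
    {![0, 0, 1], ![1, 0, 0], ![-4, -3, -1], ![-3, -2, 0], ![0, 1, 0], ![-2, -1, 0], ![-1, 0, 0]}
  nonempty := ⟨_, Finset.mem_insert_self _ _⟩
  dualPoints :=
    {![1, -1, -1], ![-1, -1, -1], ![-1, -1, 8], ![1, -1, 0], ![-1, 2, -1], ![0, -1, -1],
     ![-1, -1, 0], ![-1, -1, 1], ![-1, -1, 2], ![-1, -1, 3], ![-1, -1, 4], ![-1, -1, 5],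
     ![-1, -1, 6], ![-1, -1, 7], ![0, -1, 4], ![-1, 0, -1], ![-1, 1, -1], ![-1, 0, 5],
     ![-1, 0, 2]}
  polar_eq := by
    refine polarDual_latticeHull_eq (by decide) fun y hy => ?_
    simp [dotProduct, Fin.sum_univ_three, latticeToReal] at hy
    rcases le_total 0 (1/18 + (-1/2) * y 0 + (-1/3) * y 1 + (-1/9) * y 2 : ℝ) with hs | hs
    · refine mem_latticeHull_of_barycentric ![1, -1, -1] ![-1, -1, -1]
        ![-1, -1, 8] ![-1, 2, -1] (by decide) (by decide) (by decide) (by decide)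
        (1/2 + (1/2) * y 0 : ℝ)
        (1/18 + (-1/2) * y 0 + (-1/3) * y 1 + (-1/9) * y 2 : ℝ)
        (1/9 + (1/9) * y 2 : ℝ)
        (1/3 + (1/3) * y 1 : ℝ) ?_ ?_ ?_ ?_ ?_ ?_
      any_goals linarith
      ext i
      fin_cases i <;> simp [latticeToReal] <;> linarith
    · refine mem_latticeHull_of_barycentric ![1, -1, -1] ![1, -1, 0]
        ![-1, -1, 8] ![-1, 2, -1] (by decide) (by decide) (by decide) (by decide)
        (1 + (-4) * y 0 + (-3) * y 1 + (-1) * y 2 : ℝ)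
        (-1/2 + (9/2) * y 0 + (3) * y 1 + (1) * y 2 : ℝ)
        (1/6 + (-1/2) * y 0 + (-1/3) * y 1 : ℝ)
        (1/3 + (1/3) * y 1 : ℝ) ?_ ?_ ?_ ?_ ?_ ?_
      any_goals linarith
      ext i
      fin_cases i <;> simp [latticeToReal] <;> linarith

/-- The reflexive polytope of the singularity `Z_{1,0}`. -/
def polytopeZ10 : ReflexivePolytope where
  points :=
    {![1, -3, -1], ![2, 0, -1], ![1, 0, -1], ![0, -1, -1], ![-1, 2, 1], ![0, 1, 0]}
  nonempty := ⟨_, Finset.mem_insert_self _ _⟩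
  dualPoints :=
    {![1, -1, 2], ![0, -1, 1], ![0, 0, 1], ![4, 2, -1], ![-6, 2, -11], ![2, 0, 1], ![3, 1, 0],
     ![-2, 0, -3], ![-4, 1, -7], ![2, 1, 0], ![-3, 1, -5], ![3, 2, -2], ![2, 2, -3], ![1, 2, -4],
     ![0, 2, -5], ![-1, 2, -6], ![-2, 2, -7], ![-3, 2, -8], ![-4, 2, -9], ![-5, 2, -10]}
  polar_eq := by
    refine polarDual_latticeHull_eq (by decide) fun y hy => ?_
    simp [dotProduct, Fin.sum_univ_three, latticeToReal] at hy
    rcases le_total 0 (-2/3 + (-5/3) * y 0 + (-1) * y 1 + (2/3) * y 2 : ℝ) with hs | hs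
    · refine mem_latticeHull_of_barycentric ![1, -1, 2] ![0, -1, 1]
        ![-6, 2, -11] ![0, 0, 1] (by decide) (by decide) (by decide) (by decide)
        (1 + (2) * y 0 + (-1) * y 2 : ℝ)
        (-2/3 + (-5/3) * y 0 + (-1) * y 1 + (2/3) * y 2 : ℝ)
        (1/6 + (1/6) * y 0 + (-1/6) * y 2 : ℝ)
        (1/2 + (-1/2) * y 0 + (1) * y 1 + (1/2) * y 2 : ℝ) ?_ ?_ ?_ ?_ ?_ ?_
      any_goals linarith
      ext i
      fin_cases i <;> simp [latticeToReal] <;> linarith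
    · refine mem_latticeHull_of_barycentric ![1, -1, 2] ![4, 2, -1]
        ![-6, 2, -11] ![0, 0, 1] (by decide) (by decide) (by decide) (by decide)
        (1/3 + (1/3) * y 0 + (-1) * y 1 + (-1/3) * y 2 : ℝ)
        (1/15 + (1/6) * y 0 + (1/10) * y 1 + (-1/15) * y 2 : ℝ)
        (1/10 + (-1/10) * y 1 + (-1/10) * y 2 : ℝ)
        (1/2 + (-1/2) * y 0 + (1) * y 1 + (1/2) * y 2 : ℝ) ?_ ?_ ?_ ?_ ?_ ?_
      any_goals linarith
      ext i
      fin_cases i <;> simp [latticeToReal] <;> linarith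

/-- The reflexive polytope of the singularity `E_{25}`. -/
def polytopeE25 : ReflexivePolytope where
  points :=
    {![0, 1, 0], ![0, 0, 1], ![-3, -2, 0], ![-5, -3, -1], ![1, 0, 0], ![-1, -1, 0]}
  nonempty := ⟨_, Finset.mem_insert_self _ _⟩
  dualPoints :=
    {![-1, 2, 0], ![-1, -1, 9], ![-1, -1, -1], ![-1, 2, -1], ![1, -1, -1], ![-1, 1, 3],
     ![-1, 0, 6], ![-1, -1, 8], ![-1, -1, 7], ![-1, -1, 6], ![-1, -1, 5], ![-1, -1, 4],
     ![-1, -1, 3], ![-1, -1, 2], ![-1, -1, 1], ![-1, -1, 0], ![-1, 0, -1], ![-1, 1, -1],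
     ![0, -1, 4], ![0, -1, -1]}
  polar_eq := by
    refine polarDual_latticeHull_eq (by decide) fun y hy => ?_
    simp [dotProduct, Fin.sum_univ_three, latticeToReal] at hy
    rcases le_total 0 (1/15 + (-1/30) * y 1 + (1/10) * y 2 : ℝ) with hs | hs
    · refine mem_latticeHull_of_barycentric ![-1, 2, 0] ![-1, -1, 9]
        ![-1, -1, -1] ![1, -1, -1] (by decide) (by decide) (by decide) (by decide)
        (1/3 + (1/3) * y 1 : ℝ)
        (1/15 + (-1/30) * y 1 + (1/10) * y 2 : ℝ)
        (1/10 + (-1/2) * y 0 + (-3/10) * y 1 + (-1/10) * y 2 : ℝ)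
        (1/2 + (1/2) * y 0 : ℝ) ?_ ?_ ?_ ?_ ?_ ?_
      any_goals linarith
      ext i
      fin_cases i <;> simp [latticeToReal] <;> linarith
    · refine mem_latticeHull_of_barycentric ![-1, 2, 0] ![-1, 2, -1]
        ![-1, -1, -1] ![1, -1, -1] (by decide) (by decide) (by decide) (by decide)
        (1 + (1) * y 2 : ℝ)
        (-2/3 + (1/3) * y 1 + (-1) * y 2 : ℝ)
        (1/6 + (-1/2) * y 0 + (-1/3) * y 1 : ℝ)
        (1/2 + (1/2) * y 0 : ℝ) ?_ ?_ ?_ ?_ ?_ ?_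
      any_goals linarith
      ext i
      fin_cases i <;> simp [latticeToReal] <;> linarith

/-- The matrix carrying the polytope of `Q_{18}` to that of `Q_{12}`. -/
def matrixM₁ : Matrix (Fin 3) (Fin 3) ℤ := !![-1, 0, 1; 1, 1, -2; 2, -3, 2]

/-- The matrix carrying the polytope of `E_{25}` to that of `Z_{1,0}`. -/
def matrixM₂ : Matrix (Fin 3) (Fin 3) ℤ := !![-1, 2, 1; 1, -3, -1; 2, 0, -1]

end

noncomputable section

open CategoryTheory AlgebraicGeometry

/-! ### Functoriality of `Proj` for isomorphisms of graded algebras -/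

section GradedIso

variable {R A B : Type} [CommRing R] [CommRing A] [Algebra R A] [CommRing B] [Algebra R B]
  {𝒜 : ℕ → Submodule R A} [GradedAlgebra 𝒜] {ℬ : ℕ → Submodule R B} [GradedAlgebra ℬ]

/-! A unimodular matrix carrying Δ onto Δ' is linear, so it identifies the cones over the two
polytopes and preserves the degree in `t`. It therefore gives a graded ℂ-algebra isomorphism of the
polytope algebras, sending `χ^m t` to `χ^(mM) t`. A section goes to the section with reindexed
coefficients, so corresponding hypersurfaces are isomorphic over ℂ, for every parameter and not only
general ones (`birationalOver_quotient`, `UnimodularEquiv.birationalOver_memberToSpec`).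

On parameters, reindexing is a projective-linear bijection `e`, continuous both ways for the Zariski
topology. Given `W` and `W'`, the set `W ∩ e⁻¹(W')` and its image under `e` are the required open
sets; they are nonempty because projective space is irreducible (`IsZariskiOpen.inter_nonempty`).
What remains for the two given matrices is a finite check on spanning points. -/

/-- The structure morphism over `R` of the `Proj` of a graded `R`-algebra. -/
def projToSpec (𝒜 : ℕ → Submodule R A) [GradedAlgebra 𝒜] : Proj 𝒜 ⟶ Spec (.of R) :=
  Proj.toSpecZero 𝒜 ≫ Spec.map (CommRingCat.ofHom (algebraMap R (𝒜 0)))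

/-- The basic opens of the elements `f s`, with `s` homogeneous of positive degree, cover `Proj ℬ`
by `hf`. On each of them both morphisms come from the ring map `r ↦ r/1` into the degree-zero
localization. -/
theorem projMap_comp_projToSpec (f : 𝒜 →+*ᵍ ℬ)
    (hf : HomogeneousIdeal.irrelevant ℬ ≤ (HomogeneousIdeal.irrelevant 𝒜).map f)
    (hR : ∀ r : R, f (algebraMap R A r) = algebraMap R B r) :
    Proj.map f hf ≫ projToSpec 𝒜 = projToSpec ℬ := by
  have key (i : ℕ) (hi : 0 < i) (s : A) (hs : s ∈ 𝒜 i) :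
      Proj.awayι ℬ (f s) (f.map_mem hs) hi ≫ Proj.map f hf ≫ projToSpec 𝒜 =
        Proj.awayι ℬ (f s) (f.map_mem hs) hi ≫ projToSpec ℬ := by
    rw [Proj.awayι_comp_map_assoc f hf hi s hs, projToSpec, projToSpec,
      Proj.awayι_toSpecZero_assoc, Proj.awayι_toSpecZero_assoc, ← Spec.map_comp, ← Spec.map_comp,
      ← Spec.map_comp]
    congr 1
    ext r
    simp only [CommRingCat.hom_comp, CommRingCat.hom_ofHom, RingHom.comp_apply]
    -- The localized map applies `f` to numerator and denominator, hence the denominator `f 1`.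
    change Localization.mk (f (algebraMap R A r)) ⟨f 1, _⟩ =
      Localization.mk (algebraMap R B r) ⟨1, _⟩
    congr 1
    · exact hR r
    · exact Subtype.ext (map_one f)
  exact (Proj.mapAffineOpenCover f hf).openCover.hom_ext _ _ fun s =>
    key s.1 s.1.2 s.2 s.2.2

theorem irrelevant_le_map_of_rightInverse (f : 𝒜 →+*ᵍ ℬ) (g : ℬ →+*ᵍ 𝒜)
    (hfg : ∀ b, f (g b) = b) :
    HomogeneousIdeal.irrelevant ℬ ≤ (HomogeneousIdeal.irrelevant 𝒜).map f := by
  rw [HomogeneousIdeal.irrelevant_le]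
  intro i hi b hb
  have : f (g b) ∈ (HomogeneousIdeal.irrelevant 𝒜).map f :=
    Ideal.mem_map_of_mem f (HomogeneousIdeal.mem_irrelevant_of_mem 𝒜 hi (g.map_mem hb))
  rwa [hfg] at this

theorem projMap_eq_id (f : 𝒜 →+*ᵍ 𝒜) (h : ∀ a, f a = a)
    (hf : HomogeneousIdeal.irrelevant 𝒜 ≤ (HomogeneousIdeal.irrelevant 𝒜).map f) :
    Proj.map f hf = 𝟙 (Proj 𝒜) := by
  obtain rfl : f = .id 𝒜 := DFunLike.ext _ _ h
  exact Proj.map_id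

/-- Mutually inverse homomorphisms of graded algebras induce isomorphisms on `Proj`. -/
theorem isIso_projMap (f : 𝒜 →+*ᵍ ℬ) (g : ℬ →+*ᵍ 𝒜)
    (hfg : ∀ b, f (g b) = b) (hgf : ∀ a, g (f a) = a)
    (hf : HomogeneousIdeal.irrelevant ℬ ≤ (HomogeneousIdeal.irrelevant 𝒜).map f) :
    IsIso (Proj.map f hf) := by
  have hg := irrelevant_le_map_of_rightInverse g f hgf
  refine ⟨Proj.map g hg, ?_, ?_⟩
  · rw [← Proj.map_comp g f hg hf]
    exact projMap_eq_id _ hfg _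
  · rw [← Proj.map_comp f g hf hg]
    exact projMap_eq_id _ hgf _

/-! ### Closed subschemes of `Proj` defined by homogeneous ideals -/

/-- The homomorphism of graded quotients induced by a homomorphism of graded rings. -/
def quotientGradingMap (f : 𝒜 →+*ᵍ ℬ) (I : HomogeneousIdeal 𝒜) (J : HomogeneousIdeal ℬ)
    (h : ∀ a ∈ I.toIdeal, f a ∈ J.toIdeal) : quotientGrading 𝒜 I →+*ᵍ quotientGrading ℬ J where
  __ := Ideal.quotientMap J.toIdeal (f : A →+* B) (show I.toIdeal ≤ J.toIdeal.comap _ from h)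
  map_mem := by
    rintro i _ ⟨a, ha, rfl⟩
    exact mk_mem_quotientGrading ℬ J (f.map_mem ha)

theorem quotientGradingMap_mk (f : 𝒜 →+*ᵍ ℬ) (I : HomogeneousIdeal 𝒜) (J : HomogeneousIdeal ℬ)
    (h : ∀ a ∈ I.toIdeal, f a ∈ J.toIdeal) (a : A) :
    quotientGradingMap f I J h (Ideal.Quotient.mk _ a) = Ideal.Quotient.mk _ (f a) := rfl

theorem quotientGradingMap_leftInverse (f : 𝒜 →+*ᵍ ℬ) (g : ℬ →+*ᵍ 𝒜)
    (hgf : ∀ a, g (f a) = a) (I : HomogeneousIdeal 𝒜) (J : HomogeneousIdeal ℬ)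
    (hIJ : ∀ a ∈ I.toIdeal, f a ∈ J.toIdeal) (hJI : ∀ b ∈ J.toIdeal, g b ∈ I.toIdeal)
    (a : A ⧸ I.toIdeal) :
    quotientGradingMap g J I hJI (quotientGradingMap f I J hIJ a) = a := by
  obtain ⟨a, rfl⟩ := Ideal.Quotient.mk_surjective a
  rw [quotientGradingMap_mk, quotientGradingMap_mk, hgf]

/-- An isomorphism of graded algebras that identifies two homogeneous ideals identifies the
closed subschemes of `Proj` that they define, as schemes over the base. -/
theorem birationalOver_quotient (f : 𝒜 →+*ᵍ ℬ) (g : ℬ →+*ᵍ 𝒜)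
    (hfg : ∀ b, f (g b) = b) (hgf : ∀ a, g (f a) = a)
    (hR : ∀ r : R, f (algebraMap R A r) = algebraMap R B r)
    (I : HomogeneousIdeal 𝒜) (J : HomogeneousIdeal ℬ)
    (hIJ : ∀ a ∈ I.toIdeal, f a ∈ J.toIdeal) (hJI : ∀ b ∈ J.toIdeal, g b ∈ I.toIdeal) :
    Scheme.BirationalOver
      (Proj.map (quotientGradedHom ℬ J) (irrelevant_le_map_quotientGradedHom ℬ J) ≫ projToSpec ℬ)
      (Proj.map (quotientGradedHom 𝒜 I) (irrelevant_le_map_quotientGradedHom 𝒜 I) ≫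
        projToSpec 𝒜) := by
  have hq := irrelevant_le_map_of_rightInverse (quotientGradingMap f I J hIJ)
    (quotientGradingMap g J I hJI) (quotientGradingMap_leftInverse g f hfg J I hJI hIJ)
  have : IsIso (Proj.map (quotientGradingMap f I J hIJ) hq) :=
    isIso_projMap _ (quotientGradingMap g J I hJI)
      (quotientGradingMap_leftInverse g f hfg J I hJI hIJ)
      (quotientGradingMap_leftInverse f g hgf I J hIJ hJI) hq
  refine Scheme.Hom.birationalOver (Proj.map (quotientGradingMap f I J hIJ) hq) _ _ ?_
  have hf := irrelevant_le_map_of_rightInverse f g hfg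
  -- Both sides become `Proj.map` of a composite from `𝒜` to the quotient of `ℬ`, and the square
  -- formed by `f` and the quotient maps commutes definitionally.
  rw [← projMap_comp_projToSpec f hf hR, ← Category.assoc, ← Category.assoc,
    ← Proj.map_comp, ← Proj.map_comp]
  rfl

end GradedIso

/-! ### Zariski open subsets of the anticanonical system -/

/-- Ensures that the vanishing of a homogeneous polynomial does not depend on the arbitrary
representative `rep` of a point. -/
theorem MvPolynomial.IsHomogeneous.eval_smul_eq {σ R : Type*} [CommSemiring R]
    {p : MvPolynomial σ R} {n : ℕ} (hp : p.IsHomogeneous n) (c : R) (v : σ → R) :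
    MvPolynomial.eval (c • v) p = c ^ n * MvPolynomial.eval v p := by
  rw [MvPolynomial.eval_eq, MvPolynomial.eval_eq, Finset.mul_sum]
  refine Finset.sum_congr rfl fun d hd => ?_
  have hdeg : ∑ i ∈ d.support, d i = n := by
    rw [← hp (MvPolynomial.mem_support_iff.1 hd), Finsupp.weight_apply]
    simp [Finsupp.sum]
  simp only [Pi.smul_apply, smul_eq_mul, mul_pow, Finset.prod_mul_distrib,
    Finset.prod_pow_eq_pow_sum, hdeg]
  ring

/-- The bijection of projective spaces induced by a linear equivalence. -/
def Projectivization.congrEquiv {K V W : Type*} [DivisionRing K] [AddCommGroup V] [Module K V]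
    [AddCommGroup W] [Module K W] (L : V ≃ₗ[K] W) : Projectivization K V ≃ Projectivization K W where
  toFun := Projectivization.map L.toLinearMap L.injective
  invFun := Projectivization.map L.symm.toLinearMap L.symm.injective
  left_inv x := by
    induction x using Projectivization.ind
    simp [Projectivization.map_mk]
  right_inv x := by
    induction x using Projectivization.ind
    simp [Projectivization.map_mk]

/-- Representatives are chosen, so they commute with `L` only up to a unit. That unit affects
neither vanishing loci nor section ideals. -/
theorem Projectivization.exists_rep_congrEquiv {K V W : Type*} [DivisionRing K] [AddCommGroup V]
    [Module K V] [AddCommGroup W] [Module K W] (L : V ≃ₗ[K] W) (x : Projectivization K V) :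
    ∃ a : Kˣ, (congrEquiv L x).rep = a • L x.rep := by
  obtain ⟨a, ha⟩ := exists_smul_eq_mk_rep K (L x.rep) (by simpa using x.rep_nonzero)
  refine ⟨a, ?_⟩
  rw [ha]
  congr 1
  conv_lhs => rw [← x.mk_rep]
  rfl

namespace ReflexivePolytope

variable {Δ Δ' : ReflexivePolytope}

theorem isHomogeneous_eval_rep_mk_ne_zero {p : MvPolynomial Δ.latticePoints ℂ} {n : ℕ}
    (hp : p.IsHomogeneous n) (v : Δ.AnticanonicalSections) (hv : v ≠ 0) :
    MvPolynomial.eval (Projectivization.mk ℂ v hv).rep p ≠ 0 ↔ MvPolynomial.eval v p ≠ 0 := by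
  obtain ⟨a, ha⟩ := Projectivization.exists_smul_eq_mk_rep ℂ v hv
  have : ⇑(Projectivization.mk ℂ v hv).rep = (a : ℂ) • ⇑v := by
    rw [← ha]
    rfl
  rw [this, hp.eval_smul_eq]
  simp

theorem IsZariskiOpen.inter {W W' : Set Δ.AnticanonicalSystem} (hW : Δ.IsZariskiOpen W)
    (hW' : Δ.IsZariskiOpen W') : Δ.IsZariskiOpen (W ∩ W') := by
  obtain ⟨S, hS, rfl⟩ := hW
  obtain ⟨S', hS', rfl⟩ := hW'
  refine ⟨Set.image2 (· * ·) S S', ?_, ?_⟩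
  · rintro _ ⟨p, hp, q, hq, rfl⟩
    obtain ⟨n, hn⟩ := hS p hp
    obtain ⟨m, hm⟩ := hS' q hq
    exact ⟨n + m, hn.mul hm⟩
  · ext x
    constructor
    · rintro ⟨⟨p, hp, hpx⟩, ⟨q, hq, hqx⟩⟩
      exact ⟨_, ⟨p, hp, q, hq, rfl⟩, by simpa using ⟨hpx, hqx⟩⟩
    · rintro ⟨_, ⟨p, hp, q, hq, rfl⟩, h⟩
      simp only [map_mul] at h
      exact ⟨⟨p, hp, left_ne_zero_of_mul h⟩, ⟨q, hq, right_ne_zero_of_mul h⟩⟩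

/-- The anticanonical system is irreducible. -/
theorem IsZariskiOpen.inter_nonempty {W W' : Set Δ.AnticanonicalSystem} (hW : Δ.IsZariskiOpen W)
    (hW' : Δ.IsZariskiOpen W') (h : W.Nonempty) (h' : W'.Nonempty) : (W ∩ W').Nonempty := by
  classical
  obtain ⟨S, hS, rfl⟩ := hW
  obtain ⟨S', hS', rfl⟩ := hW'
  obtain ⟨x, p, hp, hpx⟩ := h
  obtain ⟨y, q, hq, hqy⟩ := h'
  obtain ⟨n, hn⟩ := hS p hp
  obtain ⟨m, hm⟩ := hS' q hq
  obtain ⟨i, -⟩ := Finsupp.ne_iff.1 x.rep_nonzero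
  have hp0 : p ≠ 0 := by
    rintro rfl
    simp at hpx
  have hq0 : q ≠ 0 := by
    rintro rfl
    simp at hqy
  -- The factor `X i` forces any point where `r` does not vanish to be nonzero, so that it defines a
  -- point of projective space.
  set r : MvPolynomial Δ.latticePoints ℂ := p * q * MvPolynomial.X i with hr
  have hr0 : r ≠ 0 := mul_ne_zero (mul_ne_zero hp0 hq0) (MvPolynomial.X_ne_zero i)
  obtain ⟨v, hv⟩ : ∃ v, MvPolynomial.eval v r ≠ 0 := by
    by_contra! hall
    exact hr0 (MvPolynomial.funext fun v => by simpa using hall v)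
  -- A section must have finite support, while `v` is an arbitrary function. Cutting `v` down to the
  -- variables of `r` leaves the value of `r` unchanged.
  let w : Δ.AnticanonicalSections :=
    Finsupp.onFinset r.vars (fun j => if j ∈ r.vars then v j else 0) fun j hj => by
      by_contra hj'
      simp [hj'] at hj
  have hw : MvPolynomial.eval w r ≠ 0 := by
    have : MvPolynomial.eval w r = MvPolynomial.eval v r :=
      MvPolynomial.eval₂Hom_congr' rfl (fun j hj _ => by simp [w, hj]) rfl
    rwa [this]
  rw [hr, map_mul, map_mul, MvPolynomial.eval_X] at hw
  have hw0 : w ≠ 0 := by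
    intro h0
    simp [h0] at hw
  refine ⟨Projectivization.mk ℂ w hw0, ⟨p, hp, ?_⟩, ⟨q, hq, ?_⟩⟩
  · exact (isHomogeneous_eval_rep_mk_ne_zero hn w hw0).2
      (left_ne_zero_of_mul (left_ne_zero_of_mul hw))
  · exact (isHomogeneous_eval_rep_mk_ne_zero hm w hw0).2
      (right_ne_zero_of_mul (left_ne_zero_of_mul hw))

/-- The linear equivalence of spaces of sections given by a bijection of lattice points. -/
abbrev sectionsEquiv (ε : Δ.latticePoints ≃ Δ'.latticePoints) :
    Δ.AnticanonicalSections ≃ₗ[ℂ] Δ'.AnticanonicalSections :=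
  Finsupp.domLCongr ε

theorem IsZariskiOpen.preimage_congrEquiv (ε : Δ.latticePoints ≃ Δ'.latticePoints)
    {W : Set Δ'.AnticanonicalSystem} (hW : Δ'.IsZariskiOpen W) :
    Δ.IsZariskiOpen (Projectivization.congrEquiv (sectionsEquiv ε) ⁻¹' W) := by
  obtain ⟨S, hS, rfl⟩ := hW
  -- The coefficient at `j` of the transported section is the original one at `ε.symm j`, so
  -- polynomials pull back by renaming variables along `ε.symm`.
  refine ⟨MvPolynomial.rename ε.symm '' S, ?_, ?_⟩
  · rintro _ ⟨p, hp, rfl⟩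
    obtain ⟨n, hn⟩ := hS p hp
    exact ⟨n, hn.rename_isHomogeneous⟩
  · ext x
    simp only [Set.mem_preimage, Set.mem_ofPred_eq, Set.exists_mem_image]
    refine exists_congr fun p => and_congr_right fun hp => ?_
    obtain ⟨n, hn⟩ := hS p hp
    obtain ⟨a, ha⟩ := Projectivization.exists_rep_congrEquiv (sectionsEquiv ε) x
    have : ⇑(Projectivization.congrEquiv (sectionsEquiv ε) x).rep =
        (a : ℂ) • (⇑x.rep ∘ ε.symm) := by
      rw [ha]
      ext j
      simp [Units.smul_def, Finsupp.domLCongr_apply, Finsupp.domCongr_apply]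
    rw [this, hn.eval_smul_eq, MvPolynomial.eval_rename]
    simp

/-- Families are essentially the same if a bijection of lattice points matches birationally
equivalent members. -/
theorem essentiallySame_of_equiv (ε : Δ.latticePoints ≃ Δ'.latticePoints)
    (h : ∀ x : Δ.AnticanonicalSystem, Scheme.BirationalOver (Δ.memberToSpec x)
      (Δ'.memberToSpec (Projectivization.congrEquiv (sectionsEquiv ε) x))) :
    EssentiallySame Δ Δ' := by
  intro W W' hW hWn hW' hWn'
  let e := Projectivization.congrEquiv (sectionsEquiv ε)
  have hpre : Δ.IsZariskiOpen (e ⁻¹' W') := hW'.preimage_congrEquiv ε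
  have hpre' : Δ'.IsZariskiOpen (e.symm ⁻¹' W) := hW.preimage_congrEquiv ε.symm
  have hne : (W ∩ e ⁻¹' W').Nonempty :=
    hW.inter_nonempty hpre hWn (hWn'.preimage e.surjective)
  -- The second set is the image of the first under `e`, written as a preimage under `e.symm` so
  -- that its openness is `hpre'.inter hW'`.
  refine ⟨W ∩ e ⁻¹' W', e.symm ⁻¹' W ∩ W', Set.inter_subset_left, hW.inter hpre, hne,
    Set.inter_subset_right, hpre'.inter hW', ?_, e.subtypeEquiv fun x => ?_, fun x => h x.1⟩
  · obtain ⟨x, hx, hx'⟩ := hne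
    exact ⟨e x, by simpa using hx, hx'⟩
  · simp
end ReflexivePolytope

/-! ### Unimodular equivalences of reflexive polytopes -/

theorem ReflexivePolytope.homogenize_smul (Δ : ReflexivePolytope) (c : ℂ)
    (F : Δ.AnticanonicalSections) : Δ.homogenize (c • F) = c • Δ.homogenize F := by
  rw [homogenize, homogenize, Finsupp.sum_smul_index (by simp), Finsupp.smul_sum]
  simp [AddMonoidAlgebra.smul_single]

theorem latticeToReal_vecMul (M : Matrix (Fin 3) (Fin 3) ℤ) (m : Fin 3 → ℤ) :
    latticeToReal (Matrix.vecMul m M) =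
      Matrix.vecMul (latticeToReal m) (M.map (Int.cast : ℤ → ℝ)) := by
  ext i
  simp [latticeToReal, Matrix.vecMul, dotProduct]

/-- Linear maps commute with convex hulls. This reduces an equality of real polytopes to a decidable
equality of finite sets of integer vectors. -/
theorem image_vecMul_latticeHull (M : Matrix (Fin 3) (Fin 3) ℤ) (V : Finset (Fin 3 → ℤ)) :
    (fun m : Fin 3 → ℝ => Matrix.vecMul m (M.map (Int.cast : ℤ → ℝ))) '' latticeHull V =
      latticeHull (V.image fun m => Matrix.vecMul m M) := by
  have := (Matrix.vecMulLinear (M.map (Int.cast : ℤ → ℝ))).image_convexHull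
    (latticeToReal '' (V : Set (Fin 3 → ℤ)))
  refine this.trans ?_
  rw [latticeHull, Finset.coe_image, Set.image_image, Set.image_image]
  simp only [latticeToReal_vecMul, Matrix.vecMulLinear_apply]

/-- A unimodular matrix, with its inverse, that carries one reflexive polytope onto another. -/
structure UnimodularEquiv (Δ Δ' : ReflexivePolytope) where
  toMatrix : Matrix (Fin 3) (Fin 3) ℤ
  invMatrix : Matrix (Fin 3) (Fin 3) ℤ
  mul_inv : toMatrix * invMatrix = 1
  inv_mul : invMatrix * toMatrix = 1
  image_eq : (fun m : Fin 3 → ℝ => Matrix.vecMul m (toMatrix.map (Int.cast : ℤ → ℝ))) ''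
    Δ.body = Δ'.body

namespace UnimodularEquiv

variable {Δ Δ' : ReflexivePolytope} (E : UnimodularEquiv Δ Δ')

/-- The inverse equivalence. -/
def symm : UnimodularEquiv Δ' Δ where
  toMatrix := E.invMatrix
  invMatrix := E.toMatrix
  mul_inv := E.inv_mul
  inv_mul := E.mul_inv
  image_eq := by
    have h : E.toMatrix.map (Int.cast : ℤ → ℝ) * E.invMatrix.map (Int.cast : ℤ → ℝ) = 1 := by
      have := congrArg (fun A => A.map (Int.castRingHom ℝ)) E.mul_inv
      rw [Matrix.map_mul, Matrix.map_one _ (map_zero _) (map_one _)] at this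
      exact this
    rw [← E.image_eq, Set.image_image]
    simp [Matrix.vecMul_vecMul, h]

/-- Linear maps commute with dilation, so `kΔ` is carried into `kΔ'` for every `k`. -/
theorem vecMul_mem_coneMonoid {z : (Fin 3 → ℤ) × ℕ} (hz : z ∈ Δ.coneMonoid) :
    (Matrix.vecMul z.1 E.toMatrix, z.2) ∈ Δ'.coneMonoid := by
  obtain ⟨x, hx, hxz⟩ := hz
  refine ⟨Matrix.vecMul x (E.toMatrix.map (Int.cast : ℤ → ℝ)), E.image_eq ▸ ⟨x, hx, rfl⟩, ?_⟩
  rw [latticeToReal_vecMul, ← hxz]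
  simp [Matrix.smul_vecMul]

theorem vecMul_mem_latticePoints {m : Fin 3 → ℤ} (hm : m ∈ Δ.latticePoints) :
    Matrix.vecMul m E.toMatrix ∈ Δ'.latticePoints := by
  change latticeToReal _ ∈ Δ'.body
  rw [latticeToReal_vecMul, ← E.image_eq]
  exact ⟨_, hm, rfl⟩

theorem symm_vecMul_vecMul (m : Fin 3 → ℤ) :
    Matrix.vecMul (Matrix.vecMul m E.toMatrix) E.symm.toMatrix = m := by
  rw [Matrix.vecMul_vecMul, symm, E.mul_inv, Matrix.vecMul_one]

/-- The induced bijection of lattice points. -/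
def latticePointsEquiv : Δ.latticePoints ≃ Δ'.latticePoints where
  toFun m := ⟨Matrix.vecMul m.1 E.toMatrix, E.vecMul_mem_latticePoints m.2⟩
  invFun m := ⟨Matrix.vecMul m.1 E.symm.toMatrix, E.symm.vecMul_mem_latticePoints m.2⟩
  left_inv m := Subtype.ext (E.symm_vecMul_vecMul m.1)
  right_inv m := Subtype.ext (E.symm.symm_vecMul_vecMul m.1)

/-- The induced isomorphism of cones. -/
def coneEquiv : Δ.coneMonoid ≃+ Δ'.coneMonoid where
  toFun z := ⟨(Matrix.vecMul z.1.1 E.toMatrix, z.1.2), E.vecMul_mem_coneMonoid z.2⟩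
  invFun z := ⟨(Matrix.vecMul z.1.1 E.symm.toMatrix, z.1.2), E.symm.vecMul_mem_coneMonoid z.2⟩
  left_inv z := Subtype.ext (Prod.ext (E.symm_vecMul_vecMul z.1.1) rfl)
  right_inv z := Subtype.ext (Prod.ext (E.symm.symm_vecMul_vecMul z.1.1) rfl)
  map_add' z w := Subtype.ext (Prod.ext (Matrix.add_vecMul E.toMatrix z.1.1 w.1.1) rfl)

/-- The induced isomorphism of polytope algebras. -/
def algebraEquiv : Δ.polytopeAlgebra ≃ₐ[ℂ] Δ'.polytopeAlgebra :=
  AddMonoidAlgebra.domCongr ℂ ℂ E.coneEquiv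

theorem algebraEquiv_mem_grading {k : ℕ} {a : Δ.polytopeAlgebra} (ha : a ∈ Δ.grading k) :
    E.algebraEquiv a ∈ Δ'.grading k := by
  intro z hz
  rw [algebraEquiv, AddMonoidAlgebra.domCongr_support, Finset.mem_map] at hz
  obtain ⟨w, hw, rfl⟩ := hz
  exact ha w hw

/-- The isomorphism of polytope algebras, as a homomorphism of graded rings. -/
def gradedHom : Δ.grading →+*ᵍ Δ'.grading where
  __ := (E.algebraEquiv : Δ.polytopeAlgebra →+* Δ'.polytopeAlgebra)
  map_mem := E.algebraEquiv_mem_grading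

theorem gradedHom_apply (a : Δ.polytopeAlgebra) : E.gradedHom a = E.algebraEquiv a := rfl

theorem symm_gradedHom_gradedHom (a : Δ.polytopeAlgebra) :
    E.symm.gradedHom (E.gradedHom a) = a :=
  E.algebraEquiv.symm_apply_apply a

/-- The bridge between parameters and schemes: the algebra isomorphism and the reindexing of
coefficients come from the same matrix, so they agree on each monomial `χ^m t`. -/
theorem gradedHom_homogenize (F : Δ.AnticanonicalSections) :
    E.gradedHom (Δ.homogenize F) =
      Δ'.homogenize (ReflexivePolytope.sectionsEquiv E.latticePointsEquiv F) := by
  rw [gradedHom_apply, ReflexivePolytope.homogenize, ReflexivePolytope.homogenize, map_finsuppSum,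
    Finsupp.domLCongr_apply, Finsupp.domCongr_apply, Finsupp.equivMapDomain_eq_mapDomain,
    Finsupp.sum_mapDomain_index (by simp) (by simp)]
  refine Finsupp.sum_congr fun m _ => ?_
  rw [algebraEquiv, AddMonoidAlgebra.domCongr_single]
  rfl

/-- The unit `c` accounts for the choice of representatives; it is absorbed by multiplying the
cofactor by `c⁻¹`. -/
theorem gradedHom_mem_sectionIdeal {F : Δ.AnticanonicalSections} {G : Δ'.AnticanonicalSections}
    {c : ℂˣ} (h : G = c • ReflexivePolytope.sectionsEquiv E.latticePointsEquiv F)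
    {a : Δ.polytopeAlgebra} (ha : a ∈ (Δ.sectionIdeal F).toIdeal) :
    E.gradedHom a ∈ (Δ'.sectionIdeal G).toIdeal := by
  obtain ⟨b, rfl⟩ := Ideal.mem_span_singleton'.1 ha
  refine Ideal.mem_span_singleton'.2
    ⟨(c⁻¹ : ℂˣ) • E.gradedHom b, ?_⟩
  have hG : Δ'.homogenize G = c • E.gradedHom (Δ.homogenize F) := by
    rw [E.gradedHom_homogenize, h, Units.smul_def, Units.smul_def,
      ReflexivePolytope.homogenize_smul]
  rw [hG, map_mul, smul_mul_smul_comm, inv_mul_cancel, one_smul]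

theorem birationalOver_memberToSpec (x : Δ.AnticanonicalSystem) :
    Scheme.BirationalOver (Δ.memberToSpec x) (Δ'.memberToSpec
      (Projectivization.congrEquiv (ReflexivePolytope.sectionsEquiv E.latticePointsEquiv) x)) := by
  obtain ⟨a, ha⟩ := Projectivization.exists_rep_congrEquiv
    (ReflexivePolytope.sectionsEquiv E.latticePointsEquiv) x
  -- Relation `ha` solved for `x.rep`, so that the ideal inclusion can be applied to `E.symm` as
  -- well.
  have ha' : x.rep = a⁻¹ • ReflexivePolytope.sectionsEquiv E.symm.latticePointsEquiv
      (Projectivization.congrEquiv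
        (ReflexivePolytope.sectionsEquiv E.latticePointsEquiv) x).rep := by
    have hsymm : ReflexivePolytope.sectionsEquiv E.symm.latticePointsEquiv
        (ReflexivePolytope.sectionsEquiv E.latticePointsEquiv x.rep) = x.rep :=
      (ReflexivePolytope.sectionsEquiv E.latticePointsEquiv).symm_apply_apply x.rep
    rw [ha, Units.smul_def a, map_smul, hsymm, ← Units.smul_def, inv_smul_smul]
  -- `Proj` is contravariant, so the member of the target family comes first; `symm` restores the
  -- order.
  exact (birationalOver_quotient E.gradedHom E.symm.gradedHom E.symm.symm_gradedHom_gradedHom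
    E.symm_gradedHom_gradedHom E.algebraEquiv.commutes (Δ.sectionIdeal x.rep) _
    (fun _ h => E.gradedHom_mem_sectionIdeal ha h)
    (fun _ h => E.symm.gradedHom_mem_sectionIdeal ha' h)).symm

/-- Unimodularly equivalent reflexive polytopes have essentially the same families. -/
theorem essentiallySame (E : UnimodularEquiv Δ Δ') : Δ.EssentiallySame Δ' :=
  ReflexivePolytope.essentiallySame_of_equiv E.latticePointsEquiv E.birationalOver_memberToSpec

end UnimodularEquiv

/-! ### The two explicit equivalences -/

/-- The unimodular equivalence of the polytopes of `Q_{18}` and `Q_{12}`. -/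
def equivQ18Q12 : UnimodularEquiv polytopeQ18 polytopeQ12 where
  toMatrix := matrixM₁
  -- `matrixM₁` has determinant -1, so its inverse is minus its adjugate.
  invMatrix := !![4, 3, 1; 6, 4, 1; 5, 3, 1]
  mul_inv := by decide
  inv_mul := by decide
  image_eq := by
    rw [ReflexivePolytope.body, image_vecMul_latticeHull, ReflexivePolytope.body]
    -- The matrix already matches the two lists of seven spanning points, so comparing finite sets
    -- suffices.
    congr 1
    decide

/-- The unimodular equivalence of the polytopes of `E_{25}` and `Z_{1,0}`. -/
def equivE25Z10 : UnimodularEquiv polytopeE25 polytopeZ10 where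
  toMatrix := matrixM₂
  -- `matrixM₂` has determinant 1, so its inverse is its adjugate.
  invMatrix := !![3, 2, 1; -1, -1, 0; 6, 4, 1]
  mul_inv := by decide
  inv_mul := by decide
  image_eq := by
    rw [ReflexivePolytope.body, image_vecMul_latticeHull, ReflexivePolytope.body]
    congr 1
    decide

theorem UnimodularEquiv.isUnit {Δ Δ' : ReflexivePolytope} (E : UnimodularEquiv Δ Δ') :
    IsUnit E.toMatrix :=
  ⟨⟨E.toMatrix, E.invMatrix, E.mul_inv, E.inv_mul⟩, rfl⟩

end

theorem proposition4p1 :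
    (IsUnit matrixM₁ ∧
      (fun m : Fin 3 → ℝ => Matrix.vecMul m (matrixM₁.map (Int.cast : ℤ → ℝ))) ''
        polytopeQ18.body = polytopeQ12.body) ∧
    (IsUnit matrixM₂ ∧
      (fun m : Fin 3 → ℝ => Matrix.vecMul m (matrixM₂.map (Int.cast : ℤ → ℝ))) ''
        polytopeE25.body = polytopeZ10.body) ∧
    ReflexivePolytope.EssentiallySame polytopeQ12 polytopeQ18 ∧
    ReflexivePolytope.EssentiallySame polytopeZ10 polytopeE25 :=
  ⟨⟨equivQ18Q12.isUnit, equivQ18Q12.image_eq⟩, ⟨equivE25Z10.isUnit, equivE25Z10.image_eq⟩,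
    equivQ18Q12.symm.essentiallySame, equivE25Z10.symm.essentiallySame⟩
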